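/- Setting. Let $D\subseteq\mathbb R$ be an open interval (for instance $D=\mathbb R$ or $D=(0,\infty)$) and let $f:D\to\mathbb R$ be of class $C^3$ with $f'>0$ and $f''\neq0$ on $D$. The vacuum $f(R)$ field equations for a Lorentzian metric $g$ are $$f'(R)R_{\alpha\beta}-\tfrac12 f(R)g_{\alpha\beta}-\nabla_\alpha\nabla_\beta f'(R)+\square f'(R)\,g_{\alpha\beta}=0 .$$ A spatially flat, homogeneous and isotropic solution is a metric $g=-dt^2+a(t)^2(dx^2+dy^2+dz^2)$ with a scale factor $a>0$ of class $C^4$ whose scalar curvature $R$ takes values in $D$ and which satisfies these equations. Put $F=f'(R)$ and $H=\dot a/a$. In conditions on $f$, "$f'(R)\to\infty$" refers to $R\in D$, and upper limits are taken in $[-\infty,\infty]$. Define - (f1) $f(R)-Rf'(R)<0$ on $D$, and $\dfrac{f(R)-Rf'(R)}{f'(R)^2}\to0$ as $f'(R)\to\infty$; - (f2) $2f(R)-Rf'(R)<0$ on $D$; - (f3') $\displaystyle\limsup_{f'(R)\to\infty}\frac{f(R)}{f(R)-Rf'(R)}<\sqrt3-1$. Theorem 5. (i) Let $f$ satisfy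 (f1), (f2) and (f3'), and suppose that either $f'$ is increasing, or $f'$ is decreasing and $D$ is unbounded below (so both signs of $f''$ are allowed when $D=\mathbb R$). Consider a spatially flat, homogeneous and isotropic solution that exists globally to the future (for all $t>T$, for some $T\in\mathbb R$), with $F(t)\to\infty$ as $t\to\infty$, and with $H>0$ and $\dot F/F>0$ at some initial time $t_0>T$. Then $\dot a>0$ and $\ddot a>0$ for all sufficiently large $t$, i.e. the solution undergoes accelerated expansion at late times. (ii) Let $f$ satisfy (f1) and (f2), and let $\phi=\sqrt{3/(16\pi)}\,\ln f'(R)$ and let $V$ be the function on $\phi(D)$ with $V(\phi(R))=-\dfrac{f(R)-Rf'(R)}{16\pi f'(R)^2}$ for $R\in D$. Then (f3') holds if and only if $\limsup_{\phi\to\infty}(-V'(\phi)/V(\phi))<4\sqrt\pi$, the upper limit being taken over $\phi\in\phi(D)$. (iii) For all real $\alpha>0$ and $n>2$, the function $f(R)=\alpha R^n$ on $D=(0,\infty)$ satisfies all the conditions on $f$ in (i) (with $f'$ increasing), and its potential is the exponential $$V(\phi)=\frac1{16\pi}\,\frac{\alpha(n-1)}{(\alpha n)^{n/(n-1)}}\;e^{-\sqrt{16\pi/3}\,\frac{n-2}{n-1}\,\phi},\qquad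 \phi\in\mathbb R .$$ -/

import Mathlib

open Filter Topology Set

noncomputable section

namespace FRGravity

/-! ### Curvature of a metric in global coordinates `x⁰, x¹, x², x³` -/

/-- The partial derivative `∂ᵢ u` at the point `x`. -/
def pd (i : Fin 4) (u : (Fin 4 → ℝ) → ℝ) (x : Fin 4 → ℝ) : ℝ :=
  deriv (fun s => u (Function.update x i s)) (x i)

/-- The Christoffel symbols
`Γᵏᵢⱼ = ½ gᵏˡ (∂ᵢ gⱼₗ + ∂ⱼ gᵢₗ - ∂ₗ gᵢⱼ)` of the metric `g`. -/
def christoffel (g : (Fin 4 → ℝ) → Matrix (Fin 4) (Fin 4) ℝ) (k i j : Fin 4)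
    (x : Fin 4 → ℝ) : ℝ :=
  (1 / 2) * ∑ l, (g x)⁻¹ k l *
    (pd i (fun y => g y j l) x + pd j (fun y => g y i l) x - pd l (fun y => g y i j) x)

/-- The Ricci tensor
`Rᵢⱼ = ∂ₖ Γᵏᵢⱼ - ∂ⱼ Γᵏᵢₖ + Γᵏₖₗ Γˡᵢⱼ - Γᵏⱼₗ Γˡᵢₖ` (positive for round spheres). -/
def ricci (g : (Fin 4 → ℝ) → Matrix (Fin 4) (Fin 4) ℝ) (i j : Fin 4) (x : Fin 4 → ℝ) : ℝ :=
  (∑ k, pd k (christoffel g k i j) x) - (∑ k, pd j (christoffel g k i k) x)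
    + (∑ k, ∑ l, christoffel g k k l x * christoffel g l i j x)
    - (∑ k, ∑ l, christoffel g k j l x * christoffel g l i k x)

/-- The scalar curvature `R = gⁱʲ Rᵢⱼ`. -/
def scalarCurvature (g : (Fin 4 → ℝ) → Matrix (Fin 4) (Fin 4) ℝ) (x : Fin 4 → ℝ) : ℝ :=
  ∑ i, ∑ j, (g x)⁻¹ i j * ricci g i j x

/-- The covariant Hessian `∇ᵢ∇ⱼ u = ∂ᵢ∂ⱼ u - Γᵏᵢⱼ ∂ₖ u` of a function `u`. -/
def hessian (g : (Fin 4 → ℝ) → Matrix (Fin 4) (Fin 4) ℝ) (u : (Fin 4 → ℝ) → ℝ)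
    (i j : Fin 4) (x : Fin 4 → ℝ) : ℝ :=
  pd i (pd j u) x - ∑ k, christoffel g k i j x * pd k u x

/-- The d'Alembertian `□ u = gⁱʲ ∇ᵢ∇ⱼ u`. -/
def box (g : (Fin 4 → ℝ) → Matrix (Fin 4) (Fin 4) ℝ) (u : (Fin 4 → ℝ) → ℝ)
    (x : Fin 4 → ℝ) : ℝ :=
  ∑ i, ∑ j, (g x)⁻¹ i j * hessian g u i j x

/-- The vacuum `f(R)` field equations
`f'(R) Rᵢⱼ - ½ f(R) gᵢⱼ - ∇ᵢ∇ⱼ (f'(R)) + □ (f'(R)) gᵢⱼ = 0` at the point `x`. -/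
def FieldEquationsAt (f : ℝ → ℝ) (g : (Fin 4 → ℝ) → Matrix (Fin 4) (Fin 4) ℝ)
    (x : Fin 4 → ℝ) : Prop :=
  ∀ i j : Fin 4,
    deriv f (scalarCurvature g x) * ricci g i j x
      - (1 / 2) * f (scalarCurvature g x) * g x i j
      - hessian g (fun y => deriv f (scalarCurvature g y)) i j x
      + box g (fun y => deriv f (scalarCurvature g y)) x * g x i j = 0

/-! ### Spatially flat, homogeneous and isotropic solutions -/

/-- The metric `-dt² + a(t)² (dx² + dy² + dz²)` in the coordinates `(t, x, y, z)`. -/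
def flrw (a : ℝ → ℝ) (x : Fin 4 → ℝ) : Matrix (Fin 4) (Fin 4) ℝ :=
  Matrix.diagonal ![-1, a (x 0) ^ 2, a (x 0) ^ 2, a (x 0) ^ 2]

/-- The scalar curvature of `flrw a` at time `t`; since the metric is spatially homogeneous, it is
read off at the spatial origin. -/
def curvatureAt (a : ℝ → ℝ) (t : ℝ) : ℝ := scalarCurvature (flrw a) ![t, 0, 0, 0]

/-- `F = f'(R)` at time `t`. -/
def conformalFactor (f a : ℝ → ℝ) (t : ℝ) : ℝ := deriv f (curvatureAt a t)

/-- The Hubble parameter `H = ȧ / a`. -/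
def hubble (a : ℝ → ℝ) (t : ℝ) : ℝ := deriv a t / a t

/-- `a` is the scale factor of a classical solution of the vacuum `f(R)` field equations on
`J × ℝ³`, where `J` is an open set of times and `f` is a function on `D`. -/
structure IsFlatSolution (f : ℝ → ℝ) (D : Set ℝ) (a : ℝ → ℝ) (J : Set ℝ) : Prop where
  contDiffOn : ContDiffOn ℝ 4 a J
  pos : ∀ t ∈ J, 0 < a t
  mem_domain : ∀ x : Fin 4 → ℝ, x 0 ∈ J → scalarCurvature (flrw a) x ∈ D
  field_eq : ∀ x : Fin 4 → ℝ, x 0 ∈ J → FieldEquationsAt f (flrw a) x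

/-! ### Conditions on the function `f` -/

/-- The general requirements on `f` with domain of definition `D`, an open interval. -/
structure IsTheory (f : ℝ → ℝ) (D : Set ℝ) : Prop where
  isOpen : IsOpen D
  ordConnected : D.OrdConnected
  contDiffOn : ContDiffOn ℝ 3 f D
  deriv_pos : ∀ R ∈ D, 0 < deriv f R
  deriv2_ne_zero : ∀ R ∈ D, deriv (deriv f) R ≠ 0

/-- The filter "`f'(R) → ∞`, `R ∈ D`" on the values of `R`. -/
def largeDeriv (f : ℝ → ℝ) (D : Set ℝ) : Filter ℝ := comap (deriv f) atTop ⊓ 𝓟 D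

/-- `f(R) - R f'(R) < 0`, and `(f(R) - R f'(R)) / f'(R)² → 0` as `f'(R) → ∞`. -/
def CondF1 (f : ℝ → ℝ) (D : Set ℝ) : Prop :=
  (∀ R ∈ D, f R - R * deriv f R < 0) ∧
    Tendsto (fun R => (f R - R * deriv f R) / deriv f R ^ 2) (largeDeriv f D) (𝓝 0)

/-- `2 f(R) - R f'(R) < 0`. -/
def CondF2 (f : ℝ → ℝ) (D : Set ℝ) : Prop :=
  ∀ R ∈ D, 2 * f R - R * deriv f R < 0

/-- `lim sup f(R) / (f(R) - R f'(R)) < √3 - 1` as `f'(R) → ∞`; the upper limit is taken in the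
extended reals. -/
def CondLimsup (f : ℝ → ℝ) (D : Set ℝ) : Prop :=
  limsup (fun R => ((f R / (f R - R * deriv f R) : ℝ) : EReal)) (largeDeriv f D)
    < ((√3 - 1 : ℝ) : EReal)

/-! ### The scalar field and its potential -/

/-- `φ = √(3 / (16 π)) ln f'(R)` as a function of `R`. -/
def scalarField (f : ℝ → ℝ) (R : ℝ) : ℝ := √(3 / (16 * Real.pi)) * Real.log (deriv f R)

/-- The potential as a function of `R`: `V = -(f(R) - R f'(R)) / (16 π f'(R)²)`. -/
def potentialOfCurvature (f : ℝ → ℝ) (R : ℝ) : ℝ :=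
  -(1 / (16 * Real.pi)) * ((f R - R * deriv f R) / deriv f R ^ 2)

/-- The potential `V` as a function of `φ`: the function `R` is expressed through `φ` by inverting
`R ↦ φ(R)` on `D`. -/
def potential (f : ℝ → ℝ) (D : Set ℝ) (s : ℝ) : ℝ :=
  potentialOfCurvature f (Function.invFunOn (scalarField f) D s)

/-- `lim sup (-V'/V) < 4 √π` as `φ → ∞` in the domain `φ(D)` of `V`. -/
def CondPotential (f : ℝ → ℝ) (D : Set ℝ) : Prop :=
  limsup (fun s => ((-deriv (potential f D) s / potential f D s : ℝ) : EReal))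
      (atTop ⊓ 𝓟 (scalarField f '' D))
    < ((4 * √Real.pi : ℝ) : EReal)

end FRGravity

end

noncomputable section

namespace FRGravity

/-! ### Geometry of the flat isotropic metric -/

/-! For (i), the field equations reduce to R = 6(ä/a + H²) together with (A) F ä/a = f/6 + HḞ, (B)
6H(HF + Ḟ) = RF − f, (C) F̈ + 3HḞ = (RF − 2f)/3. By (B) and f − Rf' < 0, H never vanishes, so it
stays positive; by (C) and 2f − Rf' < 0, a³Ḟ increases, so Ḟ stays positive. By (A) it remains to
show f/6 + HḞ > 0 at late times. The upper limit condition makes R eventually positive. If f'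
decreases on a domain unbounded below, F → ∞ would push R below 0, so no such solution exists. If f'
increases, F → ∞ pushes R above any given point of D. As f is increasing, one point with f ≥ 0
settles the matter. Otherwise f < 0 on D, and x = Ḟ/(FH) satisfies ẋ ≥ 2H(1 − x²); hence eventually
x ≥ 1/2 (`eventually_hubble_le`). Then (B) gives 18HḞ ≥ RF − f, where RF → ∞ while −f remains
bounded.

For (ii), the chain rule through the inverse of φ gives −V'/V = √(16π/3)(1 + f/(f − Rf'))
(`neg_deriv_potential_div`), an increasing affine function of the ratio that sends √3 − 1 to 4√π;
also φ → ∞ exactly when f' → ∞. For (iii), everything is explicit, since φ(R) = s can be solved for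
R. -/

lemma pd_eq_of_time {J : Set ℝ} (hJ : IsOpen J) {u : (Fin 4 → ℝ) → ℝ} {v : ℝ → ℝ}
    (h : ∀ y : Fin 4 → ℝ, y 0 ∈ J → u y = v (y 0)) (i : Fin 4) {x : Fin 4 → ℝ} (hx : x 0 ∈ J) :
    pd i u x = if i = 0 then deriv v (x 0) else 0 := by
  unfold pd
  split_ifs with hi
  · subst hi
    apply Filter.EventuallyEq.deriv_eq
    filter_upwards [hJ.mem_nhds hx] with s hs
    rw [h _ (by simpa using hs)]
    simp
  -- Varying a spatial coordinate keeps the line inside the time slice, so `u` is constant along all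
  -- of it.
  · have hc : ∀ s, u (Function.update x i s) = v (x 0) := fun s => by
      have h0 : Function.update x i s 0 = x 0 := Function.update_of_ne (Ne.symm hi) _ _
      rw [h _ (by rw [h0]; exact hx), h0]
    simp [hc]

/-- The Christoffel symbols of `flrw a` as functions of time. -/
def flrwChristoffel (a : ℝ → ℝ) (k i j : Fin 4) (t : ℝ) : ℝ :=
  if k = 0 then (if i = j ∧ i ≠ 0 then a t * deriv a t else 0)
  else if (i = 0 ∧ j = k) ∨ (j = 0 ∧ i = k) then deriv a t / a t else 0

/-- The components of `flrw a` as functions of time. -/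
def flrwComponent (a : ℝ → ℝ) (i j : Fin 4) (t : ℝ) : ℝ :=
  if i = j then (if i = 0 then -1 else a t ^ 2) else 0

lemma flrw_apply (a : ℝ → ℝ) (i j : Fin 4) (x : Fin 4 → ℝ) :
    flrw a x i j = flrwComponent a i j (x 0) := by
  fin_cases i <;> fin_cases j <;> simp [flrw, flrwComponent, Matrix.diagonal]

lemma flrw_inv_apply {a : ℝ → ℝ} {x : Fin 4 → ℝ} (ha : a (x 0) ≠ 0) (i j : Fin 4) :
    (flrw a x)⁻¹ i j = if i = j then (if i = 0 then -1 else (a (x 0) ^ 2)⁻¹) else 0 := by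
  have h : (flrw a x)⁻¹ =
      Matrix.diagonal ![-1, (a (x 0) ^ 2)⁻¹, (a (x 0) ^ 2)⁻¹, (a (x 0) ^ 2)⁻¹] := by
    apply Matrix.inv_eq_right_inv
    rw [flrw, Matrix.diagonal_mul_diagonal, ← Matrix.diagonal_one]
    congr 1
    ext i
    fin_cases i <;> simp [ha]
  rw [h]
  fin_cases i <;> fin_cases j <;> simp [Matrix.diagonal]

lemma deriv_flrwComponent {a : ℝ → ℝ} {t : ℝ} (hd : DifferentiableAt ℝ a t) (i j : Fin 4) :
    deriv (flrwComponent a i j) t =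
      if i = j ∧ i ≠ 0 then 2 * a t * deriv a t else 0 := by
  unfold flrwComponent
  by_cases hij : i = j <;> by_cases hi : i = 0 <;> simp [hij, hi]
  · subst hij; simp [hi]
  · subst hij
    simp only [hi, if_false]
    rw [show (fun t => a t ^ 2) = a ^ 2 from rfl, (hd.hasDerivAt.pow 2).deriv]
    simp

section Geometry

variable {a : ℝ → ℝ} {J : Set ℝ} (hJ : IsOpen J) (ha : ∀ t ∈ J, 0 < a t)
  (hd : ∀ t ∈ J, DifferentiableAt ℝ a t) (hdd : ∀ t ∈ J, DifferentiableAt ℝ (deriv a) t)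

include hJ ha hd in
lemma christoffel_flrw (k i j : Fin 4) {x : Fin 4 → ℝ} (hx : x 0 ∈ J) :
    christoffel (flrw a) k i j x = flrwChristoffel a k i j (x 0) := by
  have ha0 : a (x 0) ≠ 0 := (ha _ hx).ne'
  have hp : ∀ i j l, pd i (fun y => flrw a y j l) x =
      if i = 0 then (if j = l ∧ j ≠ 0 then 2 * a (x 0) * deriv a (x 0) else 0) else 0 := by
    intro i j l
    rw [pd_eq_of_time hJ (v := flrwComponent a j l) (fun y _ => flrw_apply a j l y) i hx,
      deriv_flrwComponent (hd _ hx)]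
  unfold christoffel flrwChristoffel
  simp only [hp, flrw_inv_apply ha0, Fin.sum_univ_four]
  fin_cases k <;> fin_cases i <;> fin_cases j <;> simp <;> field_simp

include hd hdd in
lemma deriv_flrwChristoffel_zero {t : ℝ} (ht : t ∈ J) {i j : Fin 4} :
    deriv (flrwChristoffel a 0 i j) t =
      if i = j ∧ i ≠ 0 then deriv a t ^ 2 + a t * deriv (deriv a) t else 0 := by
  have : flrwChristoffel a 0 i j = fun t => if i = j ∧ i ≠ 0 then a t * deriv a t else 0 := by
    ext t; simp [flrwChristoffel]
  rw [this]
  split_ifs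
  · have h := ((hd t ht).hasDerivAt.mul (hdd t ht).hasDerivAt).deriv
    rw [show (fun t => a t * deriv a t) = a * deriv a from rfl, h]
    ring
  · simp

include ha hd hdd in
lemma deriv_flrwChristoffel_diag {t : ℝ} (ht : t ∈ J) {k : Fin 4} (hk : k ≠ 0) :
    deriv (flrwChristoffel a k 0 k) t =
      deriv (deriv a) t / a t - (deriv a t / a t) ^ 2 := by
  have : flrwChristoffel a k 0 k = deriv a / a := by
    ext t; simp [flrwChristoffel, hk]
  rw [this, ((hdd t ht).hasDerivAt.div (hd t ht).hasDerivAt (ha t ht).ne').deriv]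
  have := (ha t ht).ne'
  field_simp

include hJ ha hd hdd in
lemma ricci_flrw_zero {x : Fin 4 → ℝ} (hx : x 0 ∈ J) :
    ricci (flrw a) 0 0 x = -3 * (deriv (deriv a) (x 0) / a (x 0)) := by
  have hp : ∀ l k i j, pd l (christoffel (flrw a) k i j) x =
      if l = 0 then deriv (flrwChristoffel a k i j) (x 0) else 0 := fun l k i j =>
    pd_eq_of_time hJ (fun y hy => christoffel_flrw hJ ha hd k i j hy) l hx
  unfold ricci
  simp only [hp, christoffel_flrw hJ ha hd _ _ _ hx, Fin.sum_univ_four,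
    deriv_flrwChristoffel_zero hd hdd hx]
  rw [deriv_flrwChristoffel_diag ha hd hdd hx (by decide : (1 : Fin 4) ≠ 0),
    deriv_flrwChristoffel_diag ha hd hdd hx (by decide : (2 : Fin 4) ≠ 0),
    deriv_flrwChristoffel_diag ha hd hdd hx (by decide : (3 : Fin 4) ≠ 0)]
  simp [flrwChristoffel]
  ring

include hJ ha hd hdd in
lemma ricci_flrw_space {x : Fin 4 → ℝ} (hx : x 0 ∈ J) {i : Fin 4} (hi : i ≠ 0) :
    ricci (flrw a) i i x = a (x 0) * deriv (deriv a) (x 0) + 2 * deriv a (x 0) ^ 2 := by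
  have ha0 := (ha _ hx).ne'
  have hp : ∀ l k i j, pd l (christoffel (flrw a) k i j) x =
      if l = 0 then deriv (flrwChristoffel a k i j) (x 0) else 0 := fun l k i j =>
    pd_eq_of_time hJ (fun y hy => christoffel_flrw hJ ha hd k i j hy) l hx
  unfold ricci
  simp only [hp, christoffel_flrw hJ ha hd _ _ _ hx, Fin.sum_univ_four,
    deriv_flrwChristoffel_zero hd hdd hx]
  fin_cases i <;> simp [flrwChristoffel] at hi ⊢ <;> field_simp <;> ring

include hJ ha hd hdd in
lemma scalarCurvature_flrw {x : Fin 4 → ℝ} (hx : x 0 ∈ J) :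
    scalarCurvature (flrw a) x =
      6 * (deriv (deriv a) (x 0) / a (x 0) + (deriv a (x 0) / a (x 0)) ^ 2) := by
  have ha0 := (ha _ hx).ne'
  have h1 := ricci_flrw_space hJ ha hd hdd hx (by decide : (1 : Fin 4) ≠ 0)
  have h2 := ricci_flrw_space hJ ha hd hdd hx (by decide : (2 : Fin 4) ≠ 0)
  have h3 := ricci_flrw_space hJ ha hd hdd hx (by decide : (3 : Fin 4) ≠ 0)
  unfold scalarCurvature
  simp [flrw_inv_apply ha0, Fin.sum_univ_four, ricci_flrw_zero hJ ha hd hdd hx, h1, h2, h3]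
  field_simp
  ring

include hJ ha hd in
lemma hessian_flrw_zero {u : (Fin 4 → ℝ) → ℝ} {v : ℝ → ℝ}
    (h : ∀ y : Fin 4 → ℝ, y 0 ∈ J → u y = v (y 0)) {x : Fin 4 → ℝ} (hx : x 0 ∈ J) :
    hessian (flrw a) u 0 0 x = deriv (deriv v) (x 0) := by
  have hp : ∀ i, ∀ y : Fin 4 → ℝ, y 0 ∈ J → pd i u y = if i = 0 then deriv v (y 0) else 0 :=
    fun i y hy => pd_eq_of_time hJ h i hy
  unfold hessian
  rw [pd_eq_of_time hJ (v := deriv v) (fun y hy => by simp [hp 0 y hy]) 0 hx]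
  simp [hp _ x hx, christoffel_flrw hJ ha hd _ _ _ hx, flrwChristoffel]

include hJ ha hd in
lemma hessian_flrw_space {u : (Fin 4 → ℝ) → ℝ} {v : ℝ → ℝ}
    (h : ∀ y : Fin 4 → ℝ, y 0 ∈ J → u y = v (y 0)) {x : Fin 4 → ℝ} (hx : x 0 ∈ J)
    {i : Fin 4} (hi : i ≠ 0) :
    hessian (flrw a) u i i x = -(a (x 0) * deriv a (x 0) * deriv v (x 0)) := by
  have hp : ∀ i, ∀ y : Fin 4 → ℝ, y 0 ∈ J → pd i u y = if i = 0 then deriv v (y 0) else 0 :=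
    fun i y hy => pd_eq_of_time hJ h i hy
  unfold hessian
  rw [pd_eq_of_time hJ (v := fun _ => 0) (fun y hy => by simp [hp i y hy, hi]) i hx]
  simp [hp _ x hx, christoffel_flrw hJ ha hd _ _ _ hx, flrwChristoffel, hi]

include hJ ha hd in
lemma box_flrw {u : (Fin 4 → ℝ) → ℝ} {v : ℝ → ℝ}
    (h : ∀ y : Fin 4 → ℝ, y 0 ∈ J → u y = v (y 0)) {x : Fin 4 → ℝ} (hx : x 0 ∈ J) :
    box (flrw a) u x =
      -deriv (deriv v) (x 0) - 3 * (deriv a (x 0) / a (x 0)) * deriv v (x 0) := by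
  have ha0 := (ha _ hx).ne'
  have h1 := hessian_flrw_space hJ ha hd h hx (by decide : (1 : Fin 4) ≠ 0)
  have h2 := hessian_flrw_space hJ ha hd h hx (by decide : (2 : Fin 4) ≠ 0)
  have h3 := hessian_flrw_space hJ ha hd h hx (by decide : (3 : Fin 4) ≠ 0)
  unfold box
  simp [flrw_inv_apply ha0, Fin.sum_univ_four, hessian_flrw_zero hJ ha hd h hx, h1, h2, h3]
  field_simp
  ring

end Geometry

/-! ### Reduction of the field equations to ordinary differential equations -/

section Reduction

variable {f a : ℝ → ℝ} {D J : Set ℝ}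

lemma IsFlatSolution.contDiffOn_deriv (h : IsFlatSolution f D a J) (hJ : IsOpen J) :
    ContDiffOn ℝ 3 (deriv a) J :=
  h.contDiffOn.deriv_of_isOpen hJ (by norm_num)

lemma IsFlatSolution.contDiffOn_deriv2 (h : IsFlatSolution f D a J) (hJ : IsOpen J) :
    ContDiffOn ℝ 2 (deriv (deriv a)) J :=
  (h.contDiffOn_deriv hJ).deriv_of_isOpen hJ (by norm_num)

lemma IsFlatSolution.differentiableAt (h : IsFlatSolution f D a J) (hJ : IsOpen J) :
    ∀ t ∈ J, DifferentiableAt ℝ a t := fun t ht =>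
  (h.contDiffOn.differentiableOn (by norm_num)).differentiableAt (hJ.mem_nhds ht)

lemma IsFlatSolution.differentiableAt_deriv (h : IsFlatSolution f D a J) (hJ : IsOpen J) :
    ∀ t ∈ J, DifferentiableAt ℝ (deriv a) t := fun t ht =>
  ((h.contDiffOn_deriv hJ).differentiableOn (by norm_num)).differentiableAt (hJ.mem_nhds ht)

lemma IsFlatSolution.curvatureAt_eq (h : IsFlatSolution f D a J) (hJ : IsOpen J) {t : ℝ}
    (ht : t ∈ J) :
    curvatureAt a t = 6 * (deriv (deriv a) t / a t + hubble a t ^ 2) := by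
  have := scalarCurvature_flrw hJ h.pos (h.differentiableAt hJ) (h.differentiableAt_deriv hJ)
    (x := ![t, 0, 0, 0]) (by simpa using ht)
  simpa [hubble, curvatureAt] using this

lemma IsFlatSolution.scalarCurvature_eq (h : IsFlatSolution f D a J) (hJ : IsOpen J)
    {x : Fin 4 → ℝ} (hx : x 0 ∈ J) : scalarCurvature (flrw a) x = curvatureAt a (x 0) := by
  rw [h.curvatureAt_eq hJ hx, hubble]
  exact scalarCurvature_flrw hJ h.pos (h.differentiableAt hJ) (h.differentiableAt_deriv hJ) hx

lemma IsFlatSolution.curvatureAt_mem (h : IsFlatSolution f D a J) {t : ℝ} (ht : t ∈ J) :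
    curvatureAt a t ∈ D :=
  h.mem_domain _ (by simpa using ht)

/-- Two derivatives of a `C⁴` scale factor enter R, and one of a `C³` function enters f', which
leaves `C²` for F: just enough for F̈. -/
lemma IsFlatSolution.contDiffOn_conformalFactor (h : IsFlatSolution f D a J) (hJ : IsOpen J)
    (hf : IsTheory f D) : ContDiffOn ℝ 2 (conformalFactor f a) J := by
  have ha : ∀ t ∈ J, a t ≠ 0 := fun t ht => (h.pos t ht).ne'
  have h0 : ContDiffOn ℝ 2 a J := h.contDiffOn.of_le (by norm_num)
  have h1 : ContDiffOn ℝ 2 (deriv a) J := (h.contDiffOn_deriv hJ).of_le (by norm_num)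
  have hR : ContDiffOn ℝ 2 (curvatureAt a) J := by
    refine ContDiffOn.congr ?_ (fun t ht => h.curvatureAt_eq hJ ht)
    exact contDiffOn_const.mul (((h.contDiffOn_deriv2 hJ).div h0 ha).add ((h1.div h0 ha).pow 2))
  have hF : ContDiffOn ℝ 2 (deriv f) D := hf.contDiffOn.deriv_of_isOpen hf.isOpen (by norm_num)
  exact hF.comp hR (fun t ht => h.curvatureAt_mem ht)

lemma IsFlatSolution.hasDerivAt_conformalFactor (h : IsFlatSolution f D a J) (hJ : IsOpen J)
    (hf : IsTheory f D) {t : ℝ} (ht : t ∈ J) :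
    HasDerivAt (conformalFactor f a) (deriv (conformalFactor f a) t) t :=
  (((h.contDiffOn_conformalFactor hJ hf).differentiableOn (by norm_num)).differentiableAt
    (hJ.mem_nhds ht)).hasDerivAt

lemma IsFlatSolution.hasDerivAt_deriv_conformalFactor (h : IsFlatSolution f D a J)
    (hJ : IsOpen J) (hf : IsTheory f D) {t : ℝ} (ht : t ∈ J) :
    HasDerivAt (deriv (conformalFactor f a)) (deriv (deriv (conformalFactor f a)) t) t := by
  have h1 : ContDiffOn ℝ 1 (deriv (conformalFactor f a)) J :=
    (h.contDiffOn_conformalFactor hJ hf).deriv_of_isOpen hJ (by norm_num)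
  exact ((h1.differentiableOn (by norm_num)).differentiableAt (hJ.mem_nhds ht)).hasDerivAt

lemma IsFlatSolution.hasDerivAt_hubble (h : IsFlatSolution f D a J) (hJ : IsOpen J) {t : ℝ}
    (ht : t ∈ J) :
    HasDerivAt (hubble a) (deriv (deriv a) t / a t - hubble a t ^ 2) t := by
  have ha := (h.pos t ht).ne'
  have := (h.differentiableAt_deriv hJ t ht).hasDerivAt.div
    (h.differentiableAt hJ t ht).hasDerivAt ha
  refine this.congr_deriv ?_
  unfold hubble
  field_simp

/-- The time-time component of the field equations. -/
lemma IsFlatSolution.acceleration_eq (h : IsFlatSolution f D a J) (hJ : IsOpen J) {t : ℝ}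
    (ht : t ∈ J) :
    deriv (deriv a) t / a t * conformalFactor f a t =
      f (curvatureAt a t) / 6 + hubble a t * deriv (conformalFactor f a) t := by
  have hu : ∀ y : Fin 4 → ℝ, y 0 ∈ J →
      deriv f (scalarCurvature (flrw a) y) = conformalFactor f a (y 0) := fun y hy => by
    rw [h.scalarCurvature_eq hJ hy, conformalFactor]
  have hx : (![t, 0, 0, 0] : Fin 4 → ℝ) 0 ∈ J := by simpa using ht
  have hd := h.differentiableAt hJ
  have e := h.field_eq ![t, 0, 0, 0] hx 0 0
  rw [hessian_flrw_zero hJ h.pos hd hu hx, box_flrw hJ h.pos hd hu hx, hu _ hx,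
    h.scalarCurvature_eq hJ hx, ricci_flrw_zero hJ h.pos hd (h.differentiableAt_deriv hJ) hx,
    flrw_apply] at e
  simp [flrwComponent] at e
  unfold hubble
  linarith

/-- Eliminating ä/a between `acceleration_eq` and the formula for R leaves a constraint without F̈.
-/
lemma IsFlatSolution.friedmann (h : IsFlatSolution f D a J) (hJ : IsOpen J) {t : ℝ}
    (ht : t ∈ J) :
    6 * hubble a t * (hubble a t * conformalFactor f a t + deriv (conformalFactor f a) t) =
      curvatureAt a t * conformalFactor f a t - f (curvatureAt a t) := by
  have h1 := h.acceleration_eq hJ ht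
  have h2 := h.curvatureAt_eq hJ ht
  linear_combination (-6) * h1 - conformalFactor f a t * h2

/-- This is the trace of the field equations, assembled from a spatial component, the time-time
component and the formula for R. -/
lemma IsFlatSolution.trace_eq (h : IsFlatSolution f D a J) (hJ : IsOpen J) {t : ℝ}
    (ht : t ∈ J) :
    deriv (deriv (conformalFactor f a)) t + 3 * hubble a t * deriv (conformalFactor f a) t =
      (curvatureAt a t * conformalFactor f a t - 2 * f (curvatureAt a t)) / 3 := by
  have hu : ∀ y : Fin 4 → ℝ, y 0 ∈ J →
      deriv f (scalarCurvature (flrw a) y) = conformalFactor f a (y 0) := fun y hy => by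
    rw [h.scalarCurvature_eq hJ hy, conformalFactor]
  have hx : (![t, 0, 0, 0] : Fin 4 → ℝ) 0 ∈ J := by simpa using ht
  have hd := h.differentiableAt hJ
  have e := h.field_eq ![t, 0, 0, 0] hx 1 1
  rw [hessian_flrw_space hJ h.pos hd hu hx (by decide : (1 : Fin 4) ≠ 0),
    box_flrw hJ h.pos hd hu hx, hu _ hx, h.scalarCurvature_eq hJ hx,
    ricci_flrw_space hJ h.pos hd (h.differentiableAt_deriv hJ) hx (by decide : (1 : Fin 4) ≠ 0),
    flrw_apply] at e
  simp [flrwComponent] at e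
  have ha := (h.pos t ht).ne'
  have h1 := h.acceleration_eq hJ ht
  have h2 := h.curvatureAt_eq hJ ht
  have e' : conformalFactor f a t * (deriv (deriv a) t / a t + 2 * hubble a t ^ 2)
      - f (curvatureAt a t) / 2 + hubble a t * deriv (conformalFactor f a) t
      - deriv (deriv (conformalFactor f a)) t
      - 3 * hubble a t * deriv (conformalFactor f a) t = 0 := by
    have : a t ^ 2 ≠ 0 := pow_ne_zero 2 ha
    apply mul_left_cancel₀ this
    rw [mul_zero, ← e]
    unfold hubble
    field_simp
    ring
  linear_combination (-1) * e' - conformalFactor f a t * h2 / 3 - h1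

lemma IsFlatSolution.conformalFactor_pos (h : IsFlatSolution f D a J) (hf : IsTheory f D)
    {t : ℝ} (ht : t ∈ J) : 0 < conformalFactor f a t :=
  hf.deriv_pos _ (h.curvatureAt_mem ht)

lemma IsFlatSolution.tendsto_curvatureAt {T : ℝ} (h : IsFlatSolution f D a (Ioi T))
    (hF : Tendsto (conformalFactor f a) atTop atTop) :
    Tendsto (curvatureAt a) atTop (largeDeriv f D) := by
  refine tendsto_inf.2 ⟨tendsto_comap_iff.2 hF, tendsto_principal.2 ?_⟩
  filter_upwards [eventually_gt_atTop T] with t ht using h.curvatureAt_mem ht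

end Reduction

/-! ### Signs of the Hubble parameter and of `Ḟ` -/

section Signs

variable {f a : ℝ → ℝ} {D : Set ℝ} {T t₀ : ℝ}

/-- At a zero of H the Friedmann equation would force Rf' − f = 0, so continuity forbids a change of
sign. -/
lemma IsFlatSolution.hubble_pos (h : IsFlatSolution f D a (Ioi T))
    (h1 : ∀ R ∈ D, f R - R * deriv f R < 0) (ht₀ : T < t₀) (hH : 0 < hubble a t₀) :
    ∀ t, T < t → 0 < hubble a t := by
  intro t ht
  by_contra hneg
  have hc : ContinuousOn (hubble a) (Ioi T) := fun s hs =>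
    (h.hasDerivAt_hubble isOpen_Ioi hs).continuousAt.continuousWithinAt
  obtain ⟨s, hs, hs0⟩ := isPreconnected_Ioi.intermediate_value (mem_Ioi.2 ht) (mem_Ioi.2 ht₀) hc
    ⟨not_lt.1 hneg, hH.le⟩
  have e := h.friedmann isOpen_Ioi hs
  have := h1 _ (h.curvatureAt_mem hs)
  rw [hs0, conformalFactor] at e
  linarith

/-- The friction term 3HḞ is absorbed by the weight a³: (a³Ḟ)˙ = a³(RF − 2f)/3, which is positive.
-/
lemma IsFlatSolution.deriv_conformalFactor_pos (h : IsFlatSolution f D a (Ioi T))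
    (hf : IsTheory f D) (h2 : CondF2 f D) (ht₀ : T < t₀)
    (hu : 0 < deriv (conformalFactor f a) t₀) :
    ∀ t, t₀ ≤ t → 0 < deriv (conformalFactor f a) t := by
  have hder : ∀ t, T < t → HasDerivAt (a ^ 3 * deriv (conformalFactor f a))
      (a t ^ 3 * ((curvatureAt a t * conformalFactor f a t - 2 * f (curvatureAt a t)) / 3)) t := by
    intro t ht
    have ha := (h.pos t ht).ne'
    refine (((h.differentiableAt isOpen_Ioi t ht).hasDerivAt.pow 3).mul
      (h.hasDerivAt_deriv_conformalFactor isOpen_Ioi hf ht)).congr_deriv ?_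
    rw [← h.trace_eq isOpen_Ioi ht, hubble]
    simp
    field_simp
    ring
  have hmono : MonotoneOn (a ^ 3 * deriv (conformalFactor f a)) (Ici t₀) := by
    refine monotoneOn_of_hasDerivWithinAt_nonneg (convex_Ici _)
      (fun s hs => (hder s (ht₀.trans_le hs)).continuousAt.continuousWithinAt)
      (fun s hs => (hder s (ht₀.trans_le (interior_subset hs))).hasDerivWithinAt) ?_
    intro s hs
    have hs' : T < s := ht₀.trans_le (interior_subset hs)
    have := h2 _ (h.curvatureAt_mem hs')
    have := h.pos s hs'
    unfold conformalFactor
    have : 0 ≤ (curvatureAt a s * deriv f (curvatureAt a s) - 2 * f (curvatureAt a s)) / 3 := by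
      linarith
    positivity
  intro t ht
  have hm := hmono (mem_Ici.2 le_rfl) (mem_Ici.2 ht) ht
  simp only [Pi.mul_apply, Pi.pow_apply] at hm
  have h3 : 0 < a t₀ ^ 3 := pow_pos (h.pos t₀ ht₀) 3
  have h4 : 0 < a t ^ 3 := pow_pos (h.pos t (ht₀.trans_le ht)) 3
  exact pos_of_mul_pos_right ((mul_pos h3 hu).trans_le hm) h4.le

/-- If `f` is negative, then `Ḟ / F` is eventually at least half of `H`. -/
lemma IsFlatSolution.eventually_hubble_le (h : IsFlatSolution f D a (Ioi T))
    (hf : IsTheory f D) (hfneg : ∀ R ∈ D, f R < 0) (ht₀ : T < t₀)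
    (hF : Tendsto (conformalFactor f a) atTop atTop) (hH : ∀ t, T < t → 0 < hubble a t)
    (hu : ∀ t, t₀ ≤ t → 0 < deriv (conformalFactor f a) t) :
    ∀ᶠ t in atTop,
      hubble a t * conformalFactor f a t ≤ 2 * deriv (conformalFactor f a) t := by
  set F := conformalFactor f a with hFdef
  set H := hubble a with hHdef
  set x : ℝ → ℝ := fun t => deriv F t / (F t * H t) with hx
  have hFpos : ∀ t, T < t → 0 < F t := fun t ht => h.conformalFactor_pos hf ht
  -- the derivative of `x`
  have hder : ∀ t, t₀ ≤ t → ∃ x', HasDerivAt x x' t ∧ 2 * H t * (1 - x t ^ 2) ≤ x' := by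
    intro t ht
    have htT : T < t := ht₀.trans_le ht
    have hd := (h.hasDerivAt_deriv_conformalFactor isOpen_Ioi hf htT).div
      ((h.hasDerivAt_conformalFactor isOpen_Ioi hf htT).mul (h.hasDerivAt_hubble isOpen_Ioi htT))
      (mul_pos (hFpos t htT) (hH t htT)).ne'
    refine ⟨_, hd, ?_⟩
    have e1 := h.acceleration_eq isOpen_Ioi htT
    have e2 := h.friedmann isOpen_Ioi htT
    have e3 := h.trace_eq isOpen_Ioi htT
    have hn := hfneg _ (h.curvatureAt_mem htT)
    have p1 := hFpos t htT
    have p2 := hH t htT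
    have p3 := hu t ht
    simp only [Pi.mul_apply, hx]
    rw [← hFdef, ← hHdef] at *
    generalize F t = Ft at *
    generalize H t = Ht at *
    generalize deriv F t = F1 at *
    generalize deriv (deriv F) t = F2 at *
    generalize f (curvatureAt a t) = φ at *
    generalize deriv (deriv a) t / a t = A at *
    have hA : A = (φ / 6 + Ht * F1) / Ft := by field_simp; linarith
    have hF2 : F2 = 2 * Ht * (Ht * Ft + F1) - φ / 3 - 3 * Ht * F1 := by linarith
    rw [← sub_nonneg]
    -- With ä/a and F̈ eliminated, the excess of ẋ over 2H(1 − x²) is −f times a positive quantity;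
    -- this is where f < 0 enters.
    have key : (F2 * (Ft * Ht) - F1 * (F1 * Ht + Ft * (A - Ht ^ 2))) / (Ft * Ht) ^ 2
        - 2 * Ht * (1 - (F1 / (Ft * Ht)) ^ 2) =
        (-φ) * (1 / (3 * Ft * Ht) + F1 / (6 * Ft ^ 2 * Ht ^ 2)) := by
      rw [hA, hF2]
      field_simp
      ring
    rw [key]
    have : 0 < -φ := by linarith
    positivity
  have hcont : ∀ t, t₀ ≤ t → ContinuousAt x t := fun t ht => (hder t ht).choose_spec.1.continuousAt
  obtain ⟨t₁, ht₁, hxt₁⟩ : ∃ t₁, t₀ ≤ t₁ ∧ 1 / 2 < x t₁ := by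
    by_contra! hcon
    -- As long as x ≤ 1/2, x grows at least as fast as 3 ln F, which is unbounded: a contradiction.
    have hmono : MonotoneOn (fun t => x t - 3 * Real.log (F t)) (Ici t₀) := by
      choose! x' hx' hx'2 using hder
      have hg : ∀ t, t₀ ≤ t → HasDerivAt (fun t => x t - 3 * Real.log (F t))
          (x' t - 3 * (deriv F t / F t)) t := fun t ht =>
        (hx' t ht).sub (((h.hasDerivAt_conformalFactor isOpen_Ioi hf (ht₀.trans_le ht)).log
          (hFpos t (ht₀.trans_le ht)).ne').const_mul 3)
      refine monotoneOn_of_hasDerivWithinAt_nonneg (convex_Ici _)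
        (fun s hs => (hg s hs).continuousAt.continuousWithinAt)
        (fun s hs => (hg s (interior_subset hs)).hasDerivWithinAt) ?_
      intro s hs
      have hs' : t₀ ≤ s := interior_subset hs
      have p1 := hFpos s (ht₀.trans_le hs')
      have p2 := hH s (ht₀.trans_le hs')
      have p3 := hu s hs'
      have b1 := hx'2 s hs'
      have b2 := hcon s hs'
      have b3 : deriv F s / F s = x s * H s := by simp only [hx]; field_simp
      have b4 : 0 ≤ x s := by simp only [hx]; positivity
      rw [b3]
      -- Since (ln F)˙ = xH, the quantity to bound is 2(1 − x²) − 3x = (1/2 − x)(2x + 4), times H.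
      have : 0 ≤ H s * ((1 / 2 - x s) * (2 * x s + 4)) := by
        have : 0 ≤ 1 / 2 - x s := by linarith
        positivity
      nlinarith
    have hlog : Tendsto (fun t => Real.log (F t)) atTop atTop := Real.tendsto_log_atTop.comp hF
    obtain ⟨t, ht, htt⟩ := ((hlog.eventually_gt_atTop
      ((1 / 2 - (x t₀ - 3 * Real.log (F t₀))) / 3)).and (eventually_ge_atTop t₀)).exists
    have m := hmono (mem_Ici.2 le_rfl) (mem_Ici.2 htt) htt
    have := hcon t htt
    simp only at m
    linarith
  filter_upwards [eventually_ge_atTop t₁] with t ht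
  have hxt : 1 / 2 ≤ x t := by
    choose! x' hx' hx'2 using hder
    -- The level 1/2 is a barrier: wherever x = 1/2, ẋ ≥ 3H/2 > 0, so x cannot fall below it again.
    have hb := image_le_of_deriv_right_lt_deriv_boundary' (f := fun s => -x s)
      (f' := fun s => -x' s) (a := t₁) (b := t) (B := fun _ => -(1 / 2)) (B' := fun _ => 0)
      (fun s hs => (hcont s (ht₁.trans hs.1)).neg.continuousWithinAt)
      (fun s hs => (hx' s (ht₁.trans hs.1)).neg.hasDerivWithinAt)
      (by linarith) continuousOn_const
      (fun s _ => hasDerivWithinAt_const _ _ _)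
      (fun s hs he => by
        have b1 := hx'2 s (ht₁.trans hs.1)
        have b2 := hH s (ht₀.trans_le (ht₁.trans hs.1))
        have b3 : x s = 1 / 2 := by linarith
        rw [b3] at b1
        linarith)
    have := hb (right_mem_Icc.2 ht)
    linarith
  have p1 := hFpos t (ht₀.trans_le (ht₁.trans ht))
  have p2 := hH t (ht₀.trans_le (ht₁.trans ht))
  simp only [hx] at hxt
  rw [le_div_iff₀ (by positivity)] at hxt
  linarith

end Signs

/-! ### Consequences of the conditions on `f` -/

section Theory

variable {f : ℝ → ℝ} {D : Set ℝ}

lemma IsTheory.contDiffOn_deriv (hf : IsTheory f D) : ContDiffOn ℝ 2 (deriv f) D :=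
  hf.contDiffOn.deriv_of_isOpen hf.isOpen (by norm_num)

lemma IsTheory.hasDerivAt (hf : IsTheory f D) {R : ℝ} (hR : R ∈ D) :
    HasDerivAt f (deriv f R) R :=
  ((hf.contDiffOn.differentiableOn (by norm_num)).differentiableAt
    (hf.isOpen.mem_nhds hR)).hasDerivAt

lemma IsTheory.hasDerivAt_deriv (hf : IsTheory f D) {R : ℝ} (hR : R ∈ D) :
    HasDerivAt (deriv f) (deriv (deriv f) R) R :=
  ((hf.contDiffOn_deriv.differentiableOn (by norm_num)).differentiableAt
    (hf.isOpen.mem_nhds hR)).hasDerivAt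

lemma IsTheory.strictMonoOn (hf : IsTheory f D) : StrictMonoOn f D :=
  strictMonoOn_of_deriv_pos hf.ordConnected.convex hf.contDiffOn.continuousOn
    (fun R hR => hf.deriv_pos R (interior_subset hR))

/-- f'' is continuous and has no zero on an interval. -/
lemma IsTheory.deriv2_pos_or_neg (hf : IsTheory f D) :
    (∀ R ∈ D, 0 < deriv (deriv f) R) ∨ (∀ R ∈ D, deriv (deriv f) R < 0) := by
  by_contra! hcon
  obtain ⟨⟨R₁, h1, h1'⟩, R₂, h2, h2'⟩ := hcon
  have hc : ContinuousOn (deriv (deriv f)) D :=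
    (hf.contDiffOn_deriv.deriv_of_isOpen (m := 1) hf.isOpen (by norm_num)).continuousOn
  obtain ⟨s, hs, hs0⟩ := hf.ordConnected.isPreconnected.intermediate_value h1 h2 hc ⟨h1', h2'⟩
  exact hf.deriv2_ne_zero s hs hs0

lemma IsTheory.deriv_strictMonoOn (hf : IsTheory f D) (h : ∀ R ∈ D, 0 < deriv (deriv f) R) :
    StrictMonoOn (deriv f) D :=
  strictMonoOn_of_deriv_pos hf.ordConnected.convex hf.contDiffOn_deriv.continuousOn
    (fun R hR => h R (interior_subset hR))

lemma IsTheory.deriv_strictAntiOn (hf : IsTheory f D) (h : ∀ R ∈ D, deriv (deriv f) R < 0) :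
    StrictAntiOn (deriv f) D :=
  strictAntiOn_of_deriv_neg hf.ordConnected.convex hf.contDiffOn_deriv.continuousOn
    (fun R hR => h R (interior_subset hR))

lemma eventually_largeDeriv_mem : ∀ᶠ R in largeDeriv f D, R ∈ D :=
  mem_inf_of_right (mem_principal_self D)

lemma tendsto_deriv_largeDeriv : Tendsto (deriv f) (largeDeriv f D) atTop :=
  tendsto_comap.mono_left inf_le_left

lemma eventually_largeDeriv_gt (hf : IsTheory f D) (h : ∀ R ∈ D, 0 < deriv (deriv f) R) {R₀ : ℝ}
    (hR₀ : R₀ ∈ D) : ∀ᶠ R in largeDeriv f D, R₀ < R := by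
  filter_upwards [eventually_largeDeriv_mem, tendsto_deriv_largeDeriv.eventually_gt_atTop
    (deriv f R₀)] with R hR hlt using ((hf.deriv_strictMonoOn h).lt_iff_lt hR₀ hR).1 hlt

lemma eventually_largeDeriv_lt (hf : IsTheory f D) (h : ∀ R ∈ D, deriv (deriv f) R < 0) {R₀ : ℝ}
    (hR₀ : R₀ ∈ D) : ∀ᶠ R in largeDeriv f D, R < R₀ := by
  filter_upwards [eventually_largeDeriv_mem, tendsto_deriv_largeDeriv.eventually_gt_atTop
    (deriv f R₀)] with R hR hlt using ((hf.deriv_strictAntiOn h).lt_iff_gt hR₀ hR).1 hlt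

/-- The condition on the upper limit forces the scalar curvature to be eventually positive. -/
lemma CondLimsup.eventually_pos (hf : IsTheory f D) (h1 : CondF1 f D) (h3 : CondLimsup f D) :
    ∀ᶠ R in largeDeriv f D, 0 < R := by
  filter_upwards [eventually_largeDeriv_mem, eventually_lt_of_limsup_lt h3] with R hR hlt
  rw [EReal.coe_lt_coe_iff] at hlt
  have hn := h1.1 R hR
  have hs : √3 < 2 := by
    rw [Real.sqrt_lt' (by norm_num)]; norm_num
  -- Here only √3 − 1 < 1 matters: with a negative denominator, a ratio below 1 means f > f − Rf'.
  have : f R / (f R - R * deriv f R) < 1 := by linarith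
  rw [div_lt_one_of_neg hn] at this
  exact pos_of_mul_pos_left (by linarith : 0 < R * deriv f R) (hf.deriv_pos R hR).le

end Theory

/-! ### Late-time acceleration -/

theorem IsFlatSolution.eventually_accelerated {f a : ℝ → ℝ} {D : Set ℝ} {T t₀ : ℝ}
    (hf : IsTheory f D) (hD : (∃ R ∈ D, deriv (deriv f) R < 0) → ¬ BddBelow D)
    (h1 : CondF1 f D) (h2 : CondF2 f D) (h3 : CondLimsup f D) (ht₀ : T < t₀)
    (h : IsFlatSolution f D a (Ioi T)) (hF : Tendsto (conformalFactor f a) atTop atTop)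
    (hH₀ : 0 < hubble a t₀)
    (hF₀ : 0 < deriv (conformalFactor f a) t₀ / conformalFactor f a t₀) :
    ∀ᶠ t in atTop, 0 < deriv a t ∧ 0 < deriv (deriv a) t := by
  have hR := h.tendsto_curvatureAt hF
  have hFpos : ∀ t, T < t → 0 < conformalFactor f a t := fun t ht => h.conformalFactor_pos hf ht
  have hH := h.hubble_pos h1.1 ht₀ hH₀
  have hu := h.deriv_conformalFactor_pos hf h2 ht₀ ((div_pos_iff_of_pos_right (hFpos t₀ ht₀)).1 hF₀)
  have hpos : ∀ᶠ t in atTop, 0 < curvatureAt a t := hR.eventually (h3.eventually_pos hf h1)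
  suffices hacc : ∀ᶠ t in atTop,
      0 < f (curvatureAt a t) / 6 + hubble a t * deriv (conformalFactor f a) t by
    filter_upwards [hacc, eventually_gt_atTop T] with t hta ht
    have ha := h.pos t ht
    rw [← h.acceleration_eq isOpen_Ioi ht] at hta
    exact ⟨(div_pos_iff_of_pos_right ha).1 (hH t ht),
      (div_pos_iff_of_pos_right ha).1 (pos_of_mul_pos_left hta (hFpos t ht).le)⟩
  rcases hf.deriv2_pos_or_neg with hs | hs
  · have hmem : curvatureAt a t₀ ∈ D := h.curvatureAt_mem ht₀
    by_cases hex : ∃ R₁ ∈ D, 0 ≤ f R₁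
    · obtain ⟨R₁, hR₁, hf₁⟩ := hex
      filter_upwards [hR.eventually (eventually_largeDeriv_gt hf hs hR₁),
        eventually_ge_atTop t₀] with t hlt ht
      have htT := ht₀.trans_le ht
      have := hf.strictMonoOn hR₁ (h.curvatureAt_mem htT) hlt
      have := mul_pos (hH t htT) (hu t ht)
      linarith
    · push Not at hex
      -- a positive lower bound `R₀` of the curvature
      obtain ⟨t₁, hR₁, ht₁⟩ := (hpos.and (eventually_gt_atTop T)).exists
      have hmem₁ := h.curvatureAt_mem ht₁
      set R₀ := curvatureAt a t₁
      -- Since HF ≤ 2Ḟ, the Friedmann equation gives f/6 + HḞ ≥ (RF + 2f)/18. Monotonicity of f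
      -- gives −f(R) < −f(R₀), so the threshold on F yields RF > R₀F > −3f(R₀) > −3f(R), more than
      -- the required −2f(R).
      filter_upwards [hR.eventually (eventually_largeDeriv_gt hf hs hmem₁),
        eventually_ge_atTop t₀, h.eventually_hubble_le hf hex ht₀ hF hH hu,
        hF.eventually_gt_atTop (3 * (-f R₀) / R₀)] with t hlt ht hle hgt
      have htT := ht₀.trans_le ht
      have hfR := hf.strictMonoOn hmem₁ (h.curvatureAt_mem htT) hlt
      have e := h.friedmann isOpen_Ioi htT
      have hneg := hex _ (h.curvatureAt_mem htT)
      have p1 := hH t htT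
      have p2 := hu t ht
      have p3 := hFpos t htT
      rw [div_lt_iff₀ hR₁] at hgt
      have b1 := mul_le_mul_of_nonneg_left hle p1.le
      have b2 := mul_lt_mul_of_pos_right hlt p3
      nlinarith
  -- With f' decreasing, F → ∞ drives R below a negative point of D, against the eventual positivity
  -- of R.
  · exfalso
    have hmem : curvatureAt a t₀ ∈ D := h.curvatureAt_mem ht₀
    have hnb := hD ⟨_, hmem, hs _ hmem⟩
    rw [not_bddBelow_iff] at hnb
    obtain ⟨R₁, hR₁, hlt⟩ := hnb 0
    obtain ⟨t, hta, htb⟩ := (hpos.and (hR.eventually (eventually_largeDeriv_lt hf hs hR₁))).exists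
    linarith

/-! ### The condition on the upper limit in terms of the potential -/

section Potential

variable {f : ℝ → ℝ} {D : Set ℝ}

/-- A real number between the two sides exists even when the upper limit is −∞, as for a trivial
filter. -/
lemma limsup_coe_lt_coe_iff {ι : Type*} {l : Filter ι} {u : ι → ℝ} {b : ℝ} :
    limsup (fun i => ((u i : ℝ) : EReal)) l < (b : EReal) ↔ ∃ c < b, ∀ᶠ i in l, u i ≤ c := by
  constructor
  · intro h
    obtain ⟨c, hc, hcb⟩ := EReal.lt_iff_exists_real_btwn.1 h
    refine ⟨c, EReal.coe_lt_coe_iff.1 hcb, ?_⟩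
    filter_upwards [eventually_lt_of_limsup_lt hc] with i hi using (EReal.coe_lt_coe_iff.1 hi).le
  · rintro ⟨c, hcb, hc⟩
    refine lt_of_le_of_lt (limsup_le_of_le (h := ?_)) (EReal.coe_lt_coe_iff.2 hcb)
    filter_upwards [hc] with i hi using EReal.coe_le_coe_iff.2 hi

lemma sqrt_scalarField_pos : 0 < √(3 / (16 * Real.pi)) := by
  have := Real.pi_pos
  positivity

lemma inv_sqrt_scalarField : (√(3 / (16 * Real.pi)))⁻¹ = √(16 * Real.pi / 3) := by
  rw [← Real.sqrt_inv, inv_div]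

lemma sqrt_mul_sqrt_three : √(16 * Real.pi / 3) * √3 = 4 * √Real.pi := by
  have := Real.pi_pos
  rw [← Real.sqrt_mul (by positivity), show 16 * Real.pi / 3 * 3 = 4 ^ 2 * Real.pi by ring,
    Real.sqrt_mul (by norm_num), Real.sqrt_sq (by norm_num)]

lemma IsTheory.injOn_deriv (hf : IsTheory f D) : InjOn (deriv f) D := by
  rcases hf.deriv2_pos_or_neg with h | h
  · exact (hf.deriv_strictMonoOn h).injOn
  · exact (hf.deriv_strictAntiOn h).injOn

lemma IsTheory.deriv_eq_exp (hf : IsTheory f D) {R : ℝ} (hR : R ∈ D) :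
    deriv f R = Real.exp (scalarField f R / √(3 / (16 * Real.pi))) := by
  rw [scalarField, mul_div_cancel_left₀ _ sqrt_scalarField_pos.ne',
    Real.exp_log (hf.deriv_pos R hR)]

lemma IsTheory.injOn_scalarField (hf : IsTheory f D) : InjOn (scalarField f) D := by
  intro R₁ h1 R₂ h2 h
  apply hf.injOn_deriv h1 h2
  rw [hf.deriv_eq_exp h1, hf.deriv_eq_exp h2, h]

lemma IsTheory.invFunOn_scalarField (hf : IsTheory f D) {R : ℝ} (hR : R ∈ D) :
    Function.invFunOn (scalarField f) D (scalarField f R) = R :=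
  hf.injOn_scalarField.leftInvOn_invFunOn hR

lemma IsTheory.potential_scalarField (hf : IsTheory f D) {R : ℝ} (hR : R ∈ D) :
    potential f D (scalarField f R) = potentialOfCurvature f R := by
  rw [potential, hf.invFunOn_scalarField hR]

lemma IsTheory.hasStrictDerivAt_scalarField (hf : IsTheory f D) {R : ℝ} (hR : R ∈ D) :
    HasStrictDerivAt (scalarField f)
      (√(3 / (16 * Real.pi)) * (deriv (deriv f) R / deriv f R)) R := by
  have h1 : HasStrictDerivAt (deriv f) (deriv (deriv f) R) R :=
    (hf.contDiffOn_deriv.contDiffAt (hf.isOpen.mem_nhds hR)).hasStrictDerivAt (by norm_num)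
  have h2 := ((Real.hasStrictDerivAt_log (hf.deriv_pos R hR).ne').comp R h1).const_mul
    (√(3 / (16 * Real.pi)))
  exact h2.congr_deriv (by rw [div_eq_inv_mul (deriv (deriv f) R)])

/-- `invFunOn` is defined by choice, but near φ(R) the local inverse from the inverse function
theorem takes values in D, so injectivity of φ on D identifies the two. -/
lemma IsTheory.hasDerivAt_invFunOn (hf : IsTheory f D) {R : ℝ} (hR : R ∈ D) :
    HasDerivAt (Function.invFunOn (scalarField f) D)
      (√(3 / (16 * Real.pi)) * (deriv (deriv f) R / deriv f R))⁻¹ (scalarField f R) := by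
  have h := hf.hasStrictDerivAt_scalarField hR
  have hne : √(3 / (16 * Real.pi)) * (deriv (deriv f) R / deriv f R) ≠ 0 :=
    mul_ne_zero sqrt_scalarField_pos.ne'
      (div_ne_zero (hf.deriv2_ne_zero R hR) (hf.deriv_pos R hR).ne')
  have hinv := h.to_localInverse hne
  refine hinv.hasDerivAt.congr_of_eventuallyEq ?_
  have hat : HasStrictDerivAt.localInverse (scalarField f) _ R h hne (scalarField f R) = R :=
    HasStrictFDerivAt.localInverse_apply_image _
  have hc := hinv.hasDerivAt.continuousAt
  have hmem : ∀ᶠ s in 𝓝 (scalarField f R),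
      HasStrictDerivAt.localInverse (scalarField f) _ R h hne s ∈ D :=
    hc.eventually_mem (by rw [hat]; exact hf.isOpen.mem_nhds hR)
  have hright : ∀ᶠ s in 𝓝 (scalarField f R),
      scalarField f (HasStrictDerivAt.localInverse (scalarField f) _ R h hne s) = s :=
    HasStrictFDerivAt.eventually_right_inverse _
  filter_upwards [hmem, hright] with s hs1 hs2
  nth_rewrite 1 [← hs2]
  exact hf.invFunOn_scalarField hs1

lemma IsTheory.hasDerivAt_potentialOfCurvature (hf : IsTheory f D) {R : ℝ} (hR : R ∈ D) :
    HasDerivAt (potentialOfCurvature f) (1 / (16 * Real.pi) *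
      (deriv (deriv f) R * (2 * f R - R * deriv f R) / deriv f R ^ 3)) R := by
  have h1 := hf.hasDerivAt hR
  have h2 := hf.hasDerivAt_deriv hR
  have hp := (hf.deriv_pos R hR).ne'
  refine (((h1.sub ((hasDerivAt_id R).mul h2)).div (h2.pow 2) (pow_ne_zero 2 hp)).const_mul
    (-(1 / (16 * Real.pi)))).congr_deriv ?_
  have := Real.pi_ne_zero
  simp
  field_simp
  ring

/-- The logarithmic slope of the potential. -/
lemma IsTheory.neg_deriv_potential_div (hf : IsTheory f D)
    (h1 : ∀ R ∈ D, f R - R * deriv f R < 0) {R : ℝ} (hR : R ∈ D) :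
    -deriv (potential f D) (scalarField f R) / potential f D (scalarField f R) =
      √(16 * Real.pi / 3) * (1 + f R / (f R - R * deriv f R)) := by
  have hV : HasDerivAt (potential f D) _ (scalarField f R) :=
    HasDerivAt.comp (h₂ := potentialOfCurvature f) (scalarField f R)
      (by rw [hf.invFunOn_scalarField hR]; exact hf.hasDerivAt_potentialOfCurvature hR)
      (hf.hasDerivAt_invFunOn hR)
  rw [hV.deriv, hf.potential_scalarField hR, potentialOfCurvature, ← inv_sqrt_scalarField]
  have a1 := (h1 R hR).ne
  have a2 := hf.deriv2_ne_zero R hR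
  have a3 := (hf.deriv_pos R hR).ne'
  have a4 := sqrt_scalarField_pos.ne'
  have a5 := Real.pi_ne_zero
  generalize √(3 / (16 * Real.pi)) = c at *
  generalize deriv (deriv f) R = f2 at *
  generalize deriv f R = f1 at *
  -- The factor f'' in dV/dR cancels the one in dφ/dR, so its sign plays no role.
  field_simp
  ring

/-- φ and f' determine each other through log and exp, both of which tend to infinity. -/
lemma IsTheory.eventually_scalarField_iff (hf : IsTheory f D) {p : ℝ → Prop} :
    (∀ᶠ s in atTop ⊓ 𝓟 (scalarField f '' D), p s) ↔
      ∀ᶠ R in largeDeriv f D, p (scalarField f R) := by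
  have hc := sqrt_scalarField_pos
  rw [largeDeriv, eventually_inf_principal, eventually_inf_principal, eventually_comap]
  constructor
  · intro h
    have ht : Tendsto (fun b => √(3 / (16 * Real.pi)) * Real.log b) atTop atTop :=
      Real.tendsto_log_atTop.const_mul_atTop hc
    filter_upwards [ht.eventually h] with b hb R hRb hR
    have e : scalarField f R = √(3 / (16 * Real.pi)) * Real.log b := by rw [scalarField, hRb]
    rw [e]
    exact hb ⟨R, hR, e⟩
  · intro h
    have ht : Tendsto (fun s => Real.exp (s / √(3 / (16 * Real.pi)))) atTop atTop :=
      Real.tendsto_exp_atTop.comp (tendsto_id.atTop_div_const hc)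
    filter_upwards [ht.eventually h] with s hs
    rintro ⟨R, hR, rfl⟩
    exact hs R (hf.deriv_eq_exp hR) hR

theorem IsTheory.condLimsup_iff_condPotential (hf : IsTheory f D)
    (h1 : ∀ R ∈ D, f R - R * deriv f R < 0) : CondLimsup f D ↔ CondPotential f D := by
  have hk : 0 < √(16 * Real.pi / 3) :=
    inv_sqrt_scalarField ▸ inv_pos.2 sqrt_scalarField_pos
  rw [CondLimsup, CondPotential, limsup_coe_lt_coe_iff, limsup_coe_lt_coe_iff]
  simp only [hf.eventually_scalarField_iff]
  have e : ∀ c, (∀ᶠ R in largeDeriv f D, -deriv (potential f D) (scalarField f R) /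
      potential f D (scalarField f R) ≤ √(16 * Real.pi / 3) * (1 + c)) ↔
      ∀ᶠ R in largeDeriv f D, f R / (f R - R * deriv f R) ≤ c := by
    intro c
    apply eventually_congr
    filter_upwards [eventually_largeDeriv_mem] with R hR
    rw [hf.neg_deriv_potential_div h1 hR, mul_le_mul_iff_right₀ hk, add_le_add_iff_left]
  constructor
  · rintro ⟨c, hc, h⟩
    refine ⟨√(16 * Real.pi / 3) * (1 + c), ?_, (e c).2 h⟩
    rw [← sqrt_mul_sqrt_three]
    exact mul_lt_mul_of_pos_left (by linarith) hk
  · rintro ⟨c, hc, h⟩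
    rw [← sqrt_mul_sqrt_three, ← div_lt_iff₀' hk] at hc
    refine ⟨c / √(16 * Real.pi / 3) - 1, by linarith, (e _).1 ?_⟩
    rwa [add_sub_cancel, mul_div_cancel₀ _ hk.ne']

end Potential

/-! ### Power laws -/

section PowerLaw

variable {α n : ℝ}

lemma deriv_const_mul_rpow (hn : 1 ≤ n) :
    deriv (fun R : ℝ => α * R ^ n) = fun R => α * n * R ^ (n - 1) := by
  ext R
  rw [((Real.hasDerivAt_rpow_const (Or.inr hn)).const_mul α).deriv]
  ring

lemma rpow_eq_rpow_sub_one_mul {R : ℝ} (hR : 0 < R) (n : ℝ) : R ^ n = R ^ (n - 1) * R := by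
  rw [Real.rpow_sub_one hR.ne', div_mul_cancel₀ _ hR.ne']

variable (hα : 0 < α) (hn : 2 < n)

include hα hn in
lemma deriv2_powerLaw_pos {R : ℝ} (hR : 0 < R) :
    0 < deriv (deriv (fun R : ℝ => α * R ^ n)) R := by
  rw [deriv_const_mul_rpow (by linarith), deriv_const_mul_rpow (by linarith)]
  have h1 : 0 < n - 1 := by linarith
  positivity

include hα hn in
lemma deriv_powerLaw_pos {R : ℝ} (hR : 0 < R) : 0 < deriv (fun R : ℝ => α * R ^ n) R := by
  rw [deriv_const_mul_rpow (by linarith)]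
  positivity

include hα hn in
lemma isTheory_powerLaw : IsTheory (fun R : ℝ => α * R ^ n) (Ioi 0) where
  isOpen := isOpen_Ioi
  ordConnected := ordConnected_Ioi
  contDiffOn := fun R (hR : 0 < R) =>
    (contDiffAt_const.mul (Real.contDiffAt_rpow_const_of_ne (ne_of_gt hR))).contDiffWithinAt
  deriv_pos := fun _ hR => deriv_powerLaw_pos hα hn hR
  deriv2_ne_zero := fun _ hR => (deriv2_powerLaw_pos hα hn hR).ne'

include hn in
lemma powerLaw_sub {R : ℝ} (hR : 0 < R) :
    α * R ^ n - R * deriv (fun R : ℝ => α * R ^ n) R = -(α * (n - 1) * R ^ n) := by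
  rw [deriv_const_mul_rpow (by linarith), rpow_eq_rpow_sub_one_mul hR n]
  ring

include hα hn in
lemma condF1_powerLaw : CondF1 (fun R : ℝ => α * R ^ n) (Ioi 0) := by
  refine ⟨fun R (hR : 0 < R) => ?_, ?_⟩
  · beta_reduce
    rw [powerLaw_sub hn hR, neg_lt_zero]
    have h1 : 0 < n - 1 := by linarith
    positivity
  · have ht : Tendsto id (largeDeriv (fun R : ℝ => α * R ^ n) (Ioi 0)) atTop := by
      rw [tendsto_atTop]
      intro b
      filter_upwards [eventually_largeDeriv_gt (isTheory_powerLaw hα hn)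
        (fun _ hR => deriv2_powerLaw_pos hα hn hR)
        (R₀ := max b 1) (mem_Ioi.2 (by positivity))] with R hR
      exact (le_max_left b 1).trans hR.le
    have h0 := ((tendsto_rpow_neg_atTop (sub_pos.2 hn)).comp ht).const_mul
      (-(α * (n - 1)) / (α * n) ^ 2)
    rw [mul_zero] at h0
    refine h0.congr' ?_
    filter_upwards [eventually_largeDeriv_mem] with R hR
    have hR' : 0 < R := hR
    rw [powerLaw_sub hn hR', deriv_const_mul_rpow (by linarith)]
    have e1 : R ^ (n - 1) = R ^ (n - 2) * R := by
      rw [rpow_eq_rpow_sub_one_mul hR' (n - 1), sub_sub]; norm_num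
    have hp : 0 < R ^ (n - 2) := Real.rpow_pos_of_pos hR' _
    simp only [Function.comp, id]
    rw [rpow_eq_rpow_sub_one_mul hR' n, e1, Real.rpow_neg hR'.le]
    have hn0 : n ≠ 0 := by linarith
    field_simp

include hα hn in
lemma condF2_powerLaw : CondF2 (fun R : ℝ => α * R ^ n) (Ioi 0) := by
  intro R (hR : 0 < R)
  have e := powerLaw_sub (α := α) hn hR
  have hp : 0 < α * R ^ n := by positivity
  nlinarith

include hα hn in
lemma condLimsup_powerLaw : CondLimsup (fun R : ℝ => α * R ^ n) (Ioi 0) := by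
  rw [CondLimsup, limsup_coe_lt_coe_iff]
  -- The ratio is the constant −1/(n − 1), so 0 already bounds it.
  refine ⟨0, by rw [sub_pos, Real.lt_sqrt] <;> norm_num, ?_⟩
  filter_upwards [eventually_largeDeriv_mem] with R hR
  have hR' : 0 < R := hR
  exact div_nonpos_of_nonneg_of_nonpos (by positivity) ((condF1_powerLaw hα hn).1 R hR).le

include hα hn in
lemma potential_powerLaw (s : ℝ) :
    potential (fun R : ℝ => α * R ^ n) (Ioi 0) s =
      (1 / (16 * Real.pi)) * (α * (n - 1) / (α * n) ^ (n / (n - 1))) *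
        Real.exp (-(√(16 * Real.pi / 3) * ((n - 2) / (n - 1)) * s)) := by
  have hαn : 0 < α * n := by positivity
  have hn1 : 0 < n - 1 := by linarith
  rw [← inv_sqrt_scalarField]
  set c := √(3 / (16 * Real.pi)) with hc
  have hcpos : 0 < c := sqrt_scalarField_pos
  -- This is the solution of αn Rⁿ⁻¹ = exp(s/c), that is, of φ(R) = s.
  set R : ℝ := (Real.exp (s / c) / (α * n)) ^ (1 / (n - 1)) with hRdef
  have hR : 0 < R := by positivity
  have hd : deriv (fun R : ℝ => α * R ^ n) R = Real.exp (s / c) := by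
    rw [deriv_const_mul_rpow (by linarith)]
    beta_reduce
    rw [hRdef, ← Real.rpow_mul (by positivity),
      one_div_mul_cancel hn1.ne', Real.rpow_one, mul_div_cancel₀ _ hαn.ne']
  have hs : scalarField (fun R : ℝ => α * R ^ n) R = s := by
    rw [scalarField, hd, Real.log_exp, ← hc, mul_div_cancel₀ _ hcpos.ne']
  have hRn : R ^ n = Real.exp (s / c * (n / (n - 1))) / (α * n) ^ (n / (n - 1)) := by
    rw [hRdef, ← Real.rpow_mul (by positivity), Real.div_rpow (Real.exp_pos _).le hαn.le,
      ← Real.exp_mul, one_div_mul_eq_div]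
  have hexp : Real.exp (s / c * (n / (n - 1))) / Real.exp (s / c) ^ 2 =
      Real.exp (-(c⁻¹ * ((n - 2) / (n - 1)) * s)) := by
    rw [← Real.exp_nat_mul, ← Real.exp_sub]
    congr 1
    push_cast
    field_simp
    ring
  nth_rewrite 1 [← hs]
  rw [(isTheory_powerLaw hα hn).potential_scalarField (mem_Ioi.2 hR), potentialOfCurvature,
    powerLaw_sub hn hR, hd, hRn, ← hexp]
  ring

end PowerLaw

end FRGravity

end

theorem theorem5 :
    -- late-time acceleration
    (∀ (f : ℝ → ℝ) (D : Set ℝ), FRGravity.IsTheory f D →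
      -- if `f'` is decreasing, then `D` is unbounded below (for instance `D = ℝ`)
      ((∃ R ∈ D, deriv (deriv f) R < 0) → ¬ BddBelow D) →
      FRGravity.CondF1 f D → FRGravity.CondF2 f D → FRGravity.CondLimsup f D →
      ∀ (a : ℝ → ℝ) (T t₀ : ℝ), T < t₀ →
        FRGravity.IsFlatSolution f D a (Set.Ioi T) →
        Filter.Tendsto (FRGravity.conformalFactor f a) Filter.atTop Filter.atTop →
        0 < FRGravity.hubble a t₀ →
        0 < deriv (FRGravity.conformalFactor f a) t₀ / FRGravity.conformalFactor f a t₀ →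
        ∀ᶠ t in Filter.atTop, 0 < deriv a t ∧ 0 < deriv (deriv a) t) ∧
    -- the condition on the upper limit in terms of the potential
    (∀ (f : ℝ → ℝ) (D : Set ℝ), FRGravity.IsTheory f D →
      FRGravity.CondF1 f D → FRGravity.CondF2 f D →
      (FRGravity.CondLimsup f D ↔ FRGravity.CondPotential f D)) ∧
    -- the example `f = α Rⁿ` on `(0, ∞)` and its exponential potential
    (∀ α n : ℝ, 0 < α → 2 < n → ∀ f : ℝ → ℝ, (f = fun R => α * R ^ n) →
      FRGravity.IsTheory f (Set.Ioi 0) ∧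
      (∀ R ∈ Set.Ioi (0 : ℝ), 0 < deriv (deriv f) R) ∧
      FRGravity.CondF1 f (Set.Ioi 0) ∧ FRGravity.CondF2 f (Set.Ioi 0) ∧
      FRGravity.CondLimsup f (Set.Ioi 0) ∧
      ∀ s : ℝ, FRGravity.potential f (Set.Ioi 0) s =
        (1 / (16 * Real.pi)) * (α * (n - 1) / (α * n) ^ (n / (n - 1))) *
          Real.exp (-(√(16 * Real.pi / 3) * ((n - 2) / (n - 1)) * s))) := by
  refine ⟨?_, ?_, ?_⟩
  · intro f D hf hD h1 h2 h3 a T t₀ ht₀ h hF hH₀ hF₀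
    exact h.eventually_accelerated hf hD h1 h2 h3 ht₀ hF hH₀ hF₀
  · intro f D hf h1 _
    exact hf.condLimsup_iff_condPotential h1.1
  · rintro α n hα hn f rfl
    exact ⟨FRGravity.isTheory_powerLaw hα hn, fun R hR => FRGravity.deriv2_powerLaw_pos hα hn hR,
      FRGravity.condF1_powerLaw hα hn, FRGravity.condF2_powerLaw hα hn,
      FRGravity.condLimsup_powerLaw hα hn, FRGravity.potential_powerLaw hα hn⟩
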